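/- Let $N$ be a positive integer, let $H$ be a complex Hilbert space of dimension $N$, and let $\mathcal{E}=\{(\lambda_j,\rho_j): j\in[M]\}$ be an ensemble of quantum states on $H$, that is, $(\lambda_j)$ is a probability distribution on $[M]$ and each $\rho_j$ is a positive semidefinite operator on $H$ of trace one. Write $\log$ for the logarithm with base $2$ and $\ln$ for the natural logarithm. For quantum states $\rho,\sigma$ on $H$ let $$ S(\rho\|\sigma)=\mathrm{Tr}\,\rho(\log\rho-\log\sigma) $$ be the relative entropy ($+\infty$ unless $\operatorname{supp}\rho\subseteq\operatorname{supp}\sigma$) and let $$ D(\rho\|\sigma)=\max_{0\le F\le I}\ \mathrm{Tr}(F\rho)\,\log\frac{\mathrm{Tr}(F\rho)}{\mathrm{Tr}(F\sigma)} $$ be the observational divergence, where $F$ ranges over all POVM elements (with $0\log\frac{0}{q}=0$ for $q\ge 0$, and $p\log\frac{p}{0}=+\infty$ for $p>0$). With $\rho=\sum_{j=1}^M\lambda_j\rho_j$, the Holevo information and the divergence information of $\mathcal{E}$ are $$ \chi(\mathcal{E})=\sum_{j=1}^M\lambda_j\,S(\rho_j\|\rho),\qquad D(\mathcal{E})=\sum_{j=1}^M\lambda_j\,D(\rho_j\|\rho).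 $$ If $\sum_{j=1}^M\lambda_j\rho_j=\frac{I}{N}$, the completely mixed state, then $K=D(\mathcal{E})$ is finite and $$ \chi(\mathcal{E})\ \le\ K\,(2\ln\log N-\ln K+1)+16, $$ where the product $K(2\ln\log N-\ln K+1)$ is read as $0$ when $K=0$ (which is always so when $N=1$). -/

import Mathlib

/-- A quantum state (density operator) on the finite-dimensional Hilbert space `H`: a positive
semidefinite operator of trace one. -/
structure QState (H : Type*) [NormedAddCommGroup H] [InnerProductSpace ℂ H] where
  op : H →L[ℂ] H
  isPositive : op.IsPositive
  trace_eq_one : LinearMap.trace ℂ H (op : H →ₗ[ℂ] H) = 1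

/-- An ensemble of `M` quantum states on `H`: states together with a probability distribution. -/
structure QEnsemble (H : Type*) [NormedAddCommGroup H] [InnerProductSpace ℂ H] (M : ℕ) where
  weight : Fin M → ℝ
  weight_nonneg : ∀ j, 0 ≤ weight j
  weight_sum : ∑ j, weight j = 1
  state : Fin M → QState H

/-- The ensemble average `∑ j, lambda j • rho j`, which is again a quantum state. -/
noncomputable def QEnsemble.average {H : Type*} [NormedAddCommGroup H] [InnerProductSpace ℂ H]
    {M : ℕ} (E : QEnsemble H M) : QState H where
  op := ∑ j, ((E.weight j : ℝ) : ℂ) • (E.state j).op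
  isPositive := by
    refine ContinuousLinearMap.isPositive_sum _ fun j _ => ?_
    exact (E.state j).isPositive.smul_of_nonneg (by exact_mod_cast E.weight_nonneg j)
  trace_eq_one := by
    have h : ((∑ j, ((E.weight j : ℝ) : ℂ) • (E.state j).op : H →L[ℂ] H) : H →ₗ[ℂ] H)
        = ∑ j, ((E.weight j : ℝ) : ℂ) • ((E.state j).op : H →ₗ[ℂ] H) := by
      ext x
      simp
    rw [h, map_sum]
    simp only [map_smul, (E.state _).trace_eq_one, smul_eq_mul, mul_one]
    exact_mod_cast E.weight_sum

/-- The binary logarithm of a self-adjoint operator, by functional calculus. On the kernel of the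
operator it takes the value `0` (as `Real.logb 2 0 = 0`). -/
noncomputable def opLogTwo {H : Type*} [NormedAddCommGroup H] [InnerProductSpace ℂ H]
    [CompleteSpace H] (A : H →L[ℂ] H) : H →L[ℂ] H :=
  cfc (Real.logb 2) A

open Classical in
/-- The quantum relative entropy `S(rho ‖ sigma) = Tr rho (log rho - log sigma)`, in bits, which is
`+∞` unless the support of `rho` is contained in that of `sigma`. -/
noncomputable def QState.relEntropy {H : Type*} [NormedAddCommGroup H] [InnerProductSpace ℂ H]
    [CompleteSpace H] (ρ σ : QState H) : EReal :=
  if LinearMap.ker (σ.op : H →ₗ[ℂ] H) ≤ LinearMap.ker (ρ.op : H →ₗ[ℂ] H) then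
    (((LinearMap.trace ℂ H
      ((ρ.op * (opLogTwo ρ.op - opLogTwo σ.op) : H →L[ℂ] H) : H →ₗ[ℂ] H)).re : ℝ) : EReal)
  else ⊤

open Classical in
/-- `p log (p / q)` in bits for `p, q ≥ 0`, with `0 log (0 / q) = 0` and `p log (p / 0) = +∞` for
`p > 0`. -/
noncomputable def mulLogDiv (p q : ℝ) : EReal :=
  if p ≠ 0 ∧ q = 0 then ⊤ else ((p * Real.logb 2 (p / q) : ℝ) : EReal)

/-- The probability `Tr (F rho)` of the POVM element `F` in the state `rho`. -/
noncomputable def QState.prob {H : Type*} [NormedAddCommGroup H] [InnerProductSpace ℂ H]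
    (ρ : QState H) (F : H →L[ℂ] H) : ℝ :=
  (LinearMap.trace ℂ H ((F * ρ.op : H →L[ℂ] H) : H →ₗ[ℂ] H)).re

/-- The observational divergence `D(rho ‖ sigma)`: the supremum of
`Tr (F rho) log (Tr (F rho) / Tr (F sigma))` over all POVM elements `0 ≤ F ≤ I`. -/
noncomputable def QState.divergence {H : Type*} [NormedAddCommGroup H] [InnerProductSpace ℂ H]
    (ρ σ : QState H) : EReal :=
  ⨆ F : {F : H →L[ℂ] H // F.IsPositive ∧ (1 - F).IsPositive}, mulLogDiv (ρ.prob F) (σ.prob F)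

/-- The Holevo information `∑ j, lambda j * S(rho j ‖ rho)`, with `rho` the ensemble average. -/
noncomputable def QEnsemble.holevoInfo {H : Type*} [NormedAddCommGroup H] [InnerProductSpace ℂ H]
    [CompleteSpace H] {M : ℕ} (E : QEnsemble H M) : EReal :=
  ∑ j, ((E.weight j : ℝ) : EReal) * (E.state j).relEntropy E.average

/-- The divergence information `∑ j, lambda j * D(rho j ‖ rho)`, with `rho` the ensemble
average. -/
noncomputable def QEnsemble.divergenceInfo {H : Type*} [NormedAddCommGroup H]
    [InnerProductSpace ℂ H] {M : ℕ} (E : QEnsemble H M) : EReal :=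
  ∑ j, ((E.weight j : ℝ) : EReal) * (E.state j).divergence E.average

/-! The average `I/N` commutes with every `ρ_j`, so each relative entropy is classical: if `ρ_j` has
eigenvalues `p i`, then `S(ρ_j‖I/N)` is the mean of `Y = log (N p i)` under the distribution `p`,
and `Y ≤ log N`. Take as POVM element the projection onto the eigenvectors with `Y ≥ t`: its
probability under `ρ_j` is at least `2^t` times that under `I/N`, so the divergence `D_j` satisfies
`t · P(Y ≥ t) ≤ D_j`. Integrating this tail bound from `c` to `log N` gives `S(ρ_j‖I/N) ≤ c + D_j
ln(log N / c)`. The right side is affine in `D_j`, so with one common `c` it averages to `χ ≤ c + K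
ln(log N / c)`. The choice `c = K` yields `K (ln log N - ln K + 1)`, already below the claimed bound
when `K > 0`. -/

lemma intervalIntegrable_ite_le (y a b : ℝ) :
    IntervalIntegrable (fun t => if t ≤ y then (1 : ℝ) else 0) MeasureTheory.volume a b :=
  (antitone_iff_forall_lt.2 fun s t hst => by split_ifs <;> linarith).intervalIntegrable

/-- Layer-cake formula cut off at `c`: everything below the cutoff, negative values of `y` included,
is absorbed in the term `c`. -/
lemma le_add_integral_indicator {c L y : ℝ} (hcL : c ≤ L) (hy : y ≤ L) :
    y ≤ c + ∫ t in c..L, (if t ≤ y then (1 : ℝ) else 0) := by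
  rcases le_total y c with h | h
  · have : 0 ≤ ∫ t in c..L, (if t ≤ y then (1 : ℝ) else 0) :=
      intervalIntegral.integral_nonneg hcL fun t _ => by split_ifs <;> norm_num
    linarith
  · have hint := intervalIntegrable_ite_le y
    have h1 : ∫ t in c..y, (if t ≤ y then (1 : ℝ) else 0) = y - c := by
      rw [intervalIntegral.integral_congr (g := fun _ => (1 : ℝ))]
      · simp
      · intro t ht
        rw [Set.uIcc_of_le h] at ht
        simp [ht.2]
    have h2 : 0 ≤ ∫ t in y..L, (if t ≤ y then (1 : ℝ) else 0) :=
      intervalIntegral.integral_nonneg hy fun t _ => by split_ifs <;> norm_num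
    rw [← intervalIntegral.integral_add_adjacent_intervals (hint c y) (hint y L)]
    linarith

/-- A bounded finite random variable whose tails decay like `D / t` has logarithmically bounded
mean. -/
lemma sum_mul_le_of_tail_le {ι : Type*} [Fintype ι] {p y : ι → ℝ} {c L D : ℝ}
    (hp : ∀ i, 0 ≤ p i) (hsum : ∑ i, p i = 1) (hc : 0 < c) (hcL : c ≤ L) (hy : ∀ i, y i ≤ L)
    (htail : ∀ t, 0 < t → t * ∑ i, (if t ≤ y i then p i else 0) ≤ D) :
    ∑ i, p i * y i ≤ c + D * Real.log (L / c) := by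
  have hint := fun i => intervalIntegrable_ite_le (y i) c L
  have hinv : IntervalIntegrable (fun t : ℝ => t⁻¹) MeasureTheory.volume c L := by
    rw [intervalIntegrable_inv_iff]
    right
    rw [Set.uIcc_of_le hcL]
    exact fun h => absurd h.1 (not_le.2 hc)
  calc ∑ i, p i * y i
      ≤ ∑ i, p i * (c + ∫ t in c..L, (if t ≤ y i then (1 : ℝ) else 0)) :=
        Finset.sum_le_sum fun i _ =>
          mul_le_mul_of_nonneg_left (le_add_integral_indicator hcL (hy i)) (hp i)
    _ = c + ∫ t in c..L, ∑ i, p i * (if t ≤ y i then (1 : ℝ) else 0) := by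
        rw [intervalIntegral.integral_finsetSum fun i _ => (hint i).const_mul _]
        simp only [mul_add, Finset.sum_add_distrib, ← Finset.sum_mul, hsum, one_mul,
          intervalIntegral.integral_const_mul]
    _ ≤ c + ∫ t in c..L, D * t⁻¹ := by
        gcongr
        refine intervalIntegral.integral_mono_on hcL ?_ (hinv.const_mul D) fun t ht => ?_
        · simpa only [Finset.sum_fn] using
            IntervalIntegrable.sum Finset.univ fun i _ => (hint i).const_mul (p i)
        · have ht0 : 0 < t := hc.trans_le ht.1
          rw [← div_eq_mul_inv, le_div_iff₀ ht0, mul_comm]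
          simpa using htail t ht0
    _ = c + D * Real.log (L / c) := by
        rw [intervalIntegral.integral_const_mul, integral_inv_of_pos hc (hc.trans_le hcL)]

/-! ### Functional calculus on an orthonormal eigenbasis -/

section Spectral

variable {H : Type*} [NormedAddCommGroup H] [InnerProductSpace ℂ H]

lemma ContinuousLinearMap.aeval_real_apply_of_apply_eq_smul {A : H →L[ℂ] H} {v : H} {r : ℝ}
    (h : A v = (r : ℂ) • v) (q : Polynomial ℝ) :
    (Polynomial.aeval A q) v = ((q.eval r : ℝ) : ℂ) • v := by
  induction q using Polynomial.induction_on' with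
  | add p q hp hq => simp [hp, hq, add_smul]
  | monomial n a =>
    have hpow : (A ^ n) v = ((r ^ n : ℝ) : ℂ) • v := by
      induction n with
      | zero => simp
      | succ n ih =>
        rw [pow_succ, mul_apply_eq_comp, h, map_smul, ih, smul_smul, pow_succ]
        push_cast
        rw [mul_comm]
    rw [Polynomial.aeval_monomial, mul_apply_eq_comp, hpow, Polynomial.eval_monomial,
      Algebra.algebraMap_eq_smul_one, smul_apply,
      one_apply_eq_self, Complex.ofReal_mul, mul_smul,
      RCLike.real_smul_eq_coe_smul (K := ℂ)]
    rfl

variable {ι : Type*} [Fintype ι]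

/-- The polynomial `∏ (X - l i)` annihilates `A`, so by spectral mapping it vanishes on the
spectrum. -/
lemma ContinuousLinearMap.exists_eq_of_mem_spectrum_real {A : H →L[ℂ] H}
    (b : OrthonormalBasis ι ℂ H) {l : ι → ℝ} (hl : ∀ i, A (b i) = (l i : ℂ) • b i) {x : ℝ}
    (hx : x ∈ spectrum ℝ A) : ∃ i, x = l i := by
  classical
  set q : Polynomial ℝ := ∏ i, (Polynomial.X - Polynomial.C (l i)) with hq
  have h0 : Polynomial.aeval A q = 0 := by
    apply ContinuousLinearMap.coe_injective
    refine b.toBasis.ext fun i => ?_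
    have : q.eval (l i) = 0 := by
      rw [hq, Polynomial.eval_prod]
      exact Finset.prod_eq_zero (Finset.mem_univ i) (by simp)
    simp [ContinuousLinearMap.aeval_real_apply_of_apply_eq_smul (hl i), this]
  have h1 := spectrum.subset_polynomial_aeval A q ⟨x, hx, rfl⟩
  have h2 : q.eval x = 0 := by
    by_contra hne
    rw [h0, spectrum.mem_iff, sub_zero] at h1
    exact h1 ((Ne.isUnit hne).map (algebraMap ℝ (H →L[ℂ] H)))
  rw [hq, Polynomial.eval_prod, Finset.prod_eq_zero_iff] at h2
  obtain ⟨i, -, hi⟩ := h2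
  exact ⟨i, by simpa [sub_eq_zero] using hi⟩

/-- The spectrum lies in the finite set of the `l i`, so `f` may be replaced there by its Lagrange
interpolant; no continuity of `f` is needed. -/
lemma ContinuousLinearMap.cfc_apply_eigenbasis [CompleteSpace H] {A : H →L[ℂ] H} (hA : IsSelfAdjoint A)
    (b : OrthonormalBasis ι ℂ H) {l : ι → ℝ} (hl : ∀ i, A (b i) = (l i : ℂ) • b i) (f : ℝ → ℝ)
    (i : ι) : cfc f A (b i) = ((f (l i) : ℝ) : ℂ) • b i := by
  classical
  set q := Lagrange.interpolate (Finset.univ.image l) id f with hq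
  have hev : ∀ i, q.eval (l i) = f (l i) := fun i =>
    Lagrange.eval_interpolate_at_node f (Set.injOn_id _)
      (Finset.mem_image_of_mem l (Finset.mem_univ i))
  have hcongr : cfc f A = cfc q.eval A := by
    refine cfc_congr fun x hx => ?_
    obtain ⟨j, rfl⟩ := exists_eq_of_mem_spectrum_real b hl hx
    exact (hev j).symm
  rw [hcongr, cfc_polynomial q A hA, aeval_real_apply_of_apply_eq_smul (hl i), hev]

end Spectral

lemma EReal.coe_sum {ι : Type*} (s : Finset ι) (f : ι → ℝ) :
    ((∑ i ∈ s, f i : ℝ) : EReal) = ∑ i ∈ s, (f i : EReal) := by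
  classical
  induction s using Finset.induction_on with
  | empty => simp
  | insert a s ha ih => rw [Finset.sum_insert ha, Finset.sum_insert ha, EReal.coe_add, ih]

/-! ### A state compared with the completely mixed state -/

namespace QState

section

variable {H : Type*} [NormedAddCommGroup H] [InnerProductSpace ℂ H] {ι : Type*} [Fintype ι]

lemma exists_eigenbasis [FiniteDimensional ℂ H] {N : ℕ} (hdim : Module.finrank ℂ H = N)
    (ρ : QState H) :
    ∃ (b : OrthonormalBasis (Fin N) ℂ H) (p : Fin N → ℝ), (∀ i, 0 ≤ p i) ∧ ∑ i, p i = 1 ∧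
      ∀ i, ρ.op (b i) = (p i : ℂ) • b i := by
  have hsymm : (ρ.op : H →ₗ[ℂ] H).IsSymmetric := ρ.isPositive.isSymmetric
  have hb := hsymm.apply_eigenvectorBasis hdim
  have hpos : (ρ.op : H →ₗ[ℂ] H).IsPositive := ρ.isPositive.toLinearMap
  refine ⟨hsymm.eigenvectorBasis hdim, hsymm.eigenvalues hdim, hpos.nonneg_eigenvalues hdim,
    ?_, hb⟩
  have htr := ρ.trace_eq_one
  rw [LinearMap.trace_eq_sum_inner _ (hsymm.eigenvectorBasis hdim)] at htr
  simp only [hb, inner_smul_right, OrthonormalBasis.inner_eq_one, mul_one] at htr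
  apply Complex.ofReal_injective
  rw [Complex.ofReal_sum, Complex.ofReal_one]
  exact htr

lemma prob_eq_sum {ρ : QState H} (b : OrthonormalBasis ι ℂ H) {p : ι → ℝ}
    (hp : ∀ i, ρ.op (b i) = (p i : ℂ) • b i) (F : H →L[ℂ] H) :
    ρ.prob F = ∑ i, p i * (inner ℂ (b i) (F (b i))).re := by
  rw [prob, LinearMap.trace_eq_sum_inner _ b, Complex.re_sum]
  refine Finset.sum_congr rfl fun i _ => ?_
  rw [ContinuousLinearMap.coe_coe, mul_apply_eq_comp, hp, map_smul, inner_smul_right,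
    Complex.re_ofReal_mul]

lemma relEntropy_eq_sum [CompleteSpace H] {ρ σ : QState H} {N : ℕ} (hN : 0 < N)
    (hσ : σ.op = ((N : ℂ)⁻¹) • (1 : H →L[ℂ] H)) (b : OrthonormalBasis ι ℂ H) {p : ι → ℝ}
    (hp : ∀ i, ρ.op (b i) = (p i : ℂ) • b i) :
    ρ.relEntropy σ = ((∑ i, p i * (Real.logb 2 (p i) + Real.logb 2 N) : ℝ) : EReal) := by
  have hN' : (N : ℂ) ≠ 0 := by exact_mod_cast hN.ne'
  have hker : LinearMap.ker (σ.op : H →ₗ[ℂ] H) ≤ LinearMap.ker (ρ.op : H →ₗ[ℂ] H) := by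
    intro x hx
    have hx' : (N : ℂ)⁻¹ • x = 0 := by simpa [hσ] using hx
    rw [smul_eq_zero_iff_right (inv_ne_zero hN')] at hx'
    simp [hx']
  have hσb : ∀ i, σ.op (b i) = (((N : ℝ)⁻¹ : ℝ) : ℂ) • b i := fun i => by simp [hσ]
  rw [relEntropy, if_pos hker, LinearMap.trace_eq_sum_inner _ b, Complex.re_sum]
  congr 1
  refine Finset.sum_congr rfl fun i _ => ?_
  rw [ContinuousLinearMap.coe_coe, mul_apply_eq_comp, sub_apply, opLogTwo, opLogTwo,
    ContinuousLinearMap.cfc_apply_eigenbasis ρ.isPositive.isSelfAdjoint b hp,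
    ContinuousLinearMap.cfc_apply_eigenbasis σ.isPositive.isSelfAdjoint b hσb, ← sub_smul,
    map_smul, hp, smul_smul, inner_smul_right, OrthonormalBasis.inner_eq_one, mul_one,
    Real.logb_inv, ← Complex.ofReal_sub, ← Complex.ofReal_mul, Complex.ofReal_re]
  ring

variable [FiniteDimensional ℂ H]

/-- Eigenvalues of `ρ` are at most `1`, hence `ρ ≤ Nσ` and the likelihood ratio of any test is at
most `N`. This makes the divergence finite. -/
lemma mulLogDiv_prob_le {ρ σ : QState H} {N : ℕ} (hN : 0 < N)
    (hdim : Module.finrank ℂ H = N) (hσ : σ.op = ((N : ℂ)⁻¹) • (1 : H →L[ℂ] H))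
    {F : H →L[ℂ] H} (hF : F.IsPositive) (hF' : (1 - F).IsPositive) :
    mulLogDiv (ρ.prob F) (σ.prob F) ≤ ((Real.logb 2 N : ℝ) : EReal) := by
  obtain ⟨b, p, hp0, hp1, hp⟩ := ρ.exists_eigenbasis hdim
  have hNpos : (0 : ℝ) < N := by exact_mod_cast hN
  have hσb : ∀ i, σ.op (b i) = (((N : ℝ)⁻¹ : ℝ) : ℂ) • b i := fun i => by simp [hσ]
  have hf0 : ∀ i, 0 ≤ (inner ℂ (b i) (F (b i))).re := fun i => hF.re_inner_nonneg_right _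
  have hf1 : ∀ i, (inner ℂ (b i) (F (b i))).re ≤ 1 := fun i => by
    have h := hF'.re_inner_nonneg_right (b i)
    rw [sub_apply, one_apply_eq_self, inner_sub_right,
      OrthonormalBasis.inner_eq_one, map_sub] at h
    simpa using h
  have hple : ∀ i, p i ≤ 1 := fun i =>
    hp1 ▸ Finset.single_le_sum (fun j _ => hp0 j) (Finset.mem_univ i)
  have hq : (N : ℝ) * σ.prob F = ∑ i, (inner ℂ (b i) (F (b i))).re := by
    rw [prob_eq_sum b hσb, ← Finset.mul_sum, mul_inv_cancel_left₀ hNpos.ne']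
  have hP0 : 0 ≤ ρ.prob F := by
    rw [prob_eq_sum b hp]
    exact Finset.sum_nonneg fun i _ => mul_nonneg (hp0 i) (hf0 i)
  have hP1 : ρ.prob F ≤ 1 := by
    rw [prob_eq_sum b hp, ← hp1]
    exact Finset.sum_le_sum fun i _ => mul_le_of_le_one_right (hp0 i) (hf1 i)
  have hPq : ρ.prob F ≤ N * σ.prob F := by
    rw [hq, prob_eq_sum b hp]
    exact Finset.sum_le_sum fun i _ => mul_le_of_le_one_left (hf0 i) (hple i)
  have hL : 0 ≤ Real.logb 2 N := Real.logb_nonneg one_lt_two (by exact_mod_cast hN)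
  rw [mulLogDiv, if_neg, EReal.coe_le_coe_iff]
  · rcases hP0.eq_or_lt with h0 | hpos
    · rw [← h0, zero_mul]
      exact hL
    · have hqpos : 0 < σ.prob F := pos_of_mul_pos_right (hpos.trans_le hPq) hNpos.le
      calc ρ.prob F * Real.logb 2 (ρ.prob F / σ.prob F)
          ≤ ρ.prob F * Real.logb 2 N := by
            gcongr
            · norm_num
            · rwa [div_le_iff₀ hqpos]
        _ ≤ Real.logb 2 N := mul_le_of_le_one_left hL hP1
  · rintro ⟨hne, hq0⟩
    rw [hq0, mul_zero] at hPq
    exact hne (le_antisymm hPq hP0)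

lemma exists_divergence_eq_coe {ρ σ : QState H} {N : ℕ} (hN : 0 < N)
    (hdim : Module.finrank ℂ H = N) (hσ : σ.op = ((N : ℂ)⁻¹) • (1 : H →L[ℂ] H)) :
    ∃ D : ℝ, ρ.divergence σ = (D : EReal) ∧ 0 ≤ D ∧ D ≤ Real.logb 2 N := by
  have hle : ρ.divergence σ ≤ ((Real.logb 2 N : ℝ) : EReal) :=
    iSup_le fun F => mulLogDiv_prob_le hN hdim hσ F.2.1 F.2.2
  have hge : (0 : EReal) ≤ ρ.divergence σ := by
    refine le_iSup_of_le ⟨0, ContinuousLinearMap.isPositive_zero, ?_⟩ ?_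
    · rw [sub_zero]
      exact ContinuousLinearMap.isPositive_one
    · simp [mulLogDiv, prob]
  have hD : ρ.divergence σ = ((ρ.divergence σ).toReal : EReal) :=
    (EReal.coe_toReal (hle.trans_lt (EReal.coe_lt_top _)).ne
      (EReal.bot_lt_zero.trans_le hge).ne').symm
  refine ⟨_, hD, ?_, ?_⟩
  · rw [hD] at hge
    exact_mod_cast hge
  · rw [hD] at hle
    exact_mod_cast hle

/-- Testing against the projection onto the eigenvectors indexed by `s` bounds the divergence from
the completely mixed state from below. -/
lemma sum_mul_logb_le_divergence {ρ σ : QState H} {N : ℕ}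
    (hσ : σ.op = ((N : ℂ)⁻¹) • (1 : H →L[ℂ] H)) (b : OrthonormalBasis ι ℂ H) {p : ι → ℝ}
    (hp : ∀ i, ρ.op (b i) = (p i : ℂ) • b i) {D : ℝ} (hD : ρ.divergence σ = (D : EReal))
    (s : Finset ι) :
    (∑ i ∈ s, p i) * Real.logb 2 ((∑ i ∈ s, p i) / ((N : ℝ)⁻¹ * s.card)) ≤ D := by
  classical
  have : CompleteSpace H := FiniteDimensional.complete ℂ H
  have hσb : ∀ i, σ.op (b i) = (((N : ℝ)⁻¹ : ℝ) : ℂ) • b i := fun i => by simp [hσ]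
  set U : Submodule ℂ H := Submodule.span ℂ (b '' s) with hU
  have hF : U.starProjection.IsPositive :=
    ContinuousLinearMap.IsPositive.of_isStarProjection isStarProjection_starProjection
  have hF' : (1 - U.starProjection).IsPositive :=
    ContinuousLinearMap.IsPositive.of_isStarProjection isStarProjection_starProjection.one_sub
  have hin : ∀ i, (inner ℂ (b i) (U.starProjection (b i))).re = if i ∈ s then 1 else 0 := by
    intro i
    split_ifs with hi
    · have : b i ∈ U := Submodule.subset_span ⟨i, hi, rfl⟩
      rw [Submodule.starProjection_eq_self_iff.2 this, OrthonormalBasis.inner_eq_one,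
        Complex.one_re]
    · have : b i ∈ Uᗮ := by
        rw [Submodule.mem_orthogonal]
        intro u hu
        induction hu using Submodule.span_induction with
        | mem x hx =>
          obtain ⟨j, hj, rfl⟩ := hx
          exact b.inner_eq_zero fun h => hi (h ▸ hj)
        | zero => simp
        | add x y _ _ hx hy => rw [inner_add_left, hx, hy, add_zero]
        | smul a x _ hx => rw [inner_smul_left, hx, mul_zero]
      rw [(Submodule.starProjection_apply_eq_zero_iff U).2 this, inner_zero_right, Complex.zero_re]
  have hρF : ρ.prob U.starProjection = ∑ i ∈ s, p i := by
    simp [prob_eq_sum b hp, hin]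
  have hσF : σ.prob U.starProjection = (N : ℝ)⁻¹ * s.card := by
    simp [prob_eq_sum b hσb, hin, mul_comm]
  have h : mulLogDiv (ρ.prob U.starProjection) (σ.prob U.starProjection) ≤ (D : EReal) :=
    hD ▸ le_iSup (fun F : {F : H →L[ℂ] H // F.IsPositive ∧ (1 - F).IsPositive} =>
      mulLogDiv (ρ.prob F) (σ.prob F)) ⟨U.starProjection, hF, hF'⟩
  rw [mulLogDiv] at h
  split_ifs at h with hc
  · exact absurd h (not_le.2 (EReal.coe_lt_top D))
  · rwa [EReal.coe_le_coe_iff, hρF, hσF] at h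

/-- Each eigenvalue in the tail is at least `2^t / N`, so the spectral projection onto the tail has
likelihood ratio at least `2^t`. -/
lemma mul_sum_tail_le_divergence {ρ σ : QState H} {N : ℕ} (hN : 0 < N)
    (hσ : σ.op = ((N : ℂ)⁻¹) • (1 : H →L[ℂ] H)) (b : OrthonormalBasis ι ℂ H) {p : ι → ℝ}
    (hp0 : ∀ i, 0 ≤ p i) (hp : ∀ i, ρ.op (b i) = (p i : ℂ) • b i) {D : ℝ}
    (hD : ρ.divergence σ = (D : EReal)) (hD0 : 0 ≤ D) (t : ℝ) :
    t * ∑ i, (if t ≤ Real.logb 2 (p i) + Real.logb 2 N then p i else 0) ≤ D := by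
  classical
  have hNpos : (0 : ℝ) < N := by exact_mod_cast hN
  -- Zero eigenvalues are removed: as `Real.logb 2 0 = 0`, they would pass the test `t ≤ log N` yet
  -- violate `hlow`.
  set s : Finset ι := Finset.univ.filter fun i =>
    t ≤ Real.logb 2 (p i) + Real.logb 2 N ∧ p i ≠ 0 with hs
  have hsum : ∑ i, (if t ≤ Real.logb 2 (p i) + Real.logb 2 N then p i else 0) = ∑ i ∈ s, p i := by
    rw [hs, Finset.sum_filter]
    refine Finset.sum_congr rfl fun i _ => ?_
    by_cases h : p i = 0 <;> simp [h]
  rw [hsum]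
  rcases s.eq_empty_or_nonempty with he | hne
  · simpa [he] using hD0
  have hcard : (0 : ℝ) < s.card := by exact_mod_cast hne.card_pos
  have hlow : ∀ i ∈ s, (2 : ℝ) ^ t * (N : ℝ)⁻¹ ≤ p i := by
    intro i hi
    obtain ⟨-, hti, hpi⟩ := Finset.mem_filter.1 hi
    have hpos : 0 < p i := (hp0 i).lt_of_ne' hpi
    rw [← Real.logb_mul hpos.ne' hNpos.ne', Real.le_logb_iff_rpow_le one_lt_two (by positivity)]
      at hti
    rwa [← div_eq_mul_inv, div_le_iff₀ hNpos]
  have hmass : (2 : ℝ) ^ t * ((N : ℝ)⁻¹ * s.card) ≤ ∑ i ∈ s, p i := by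
    have := Finset.card_nsmul_le_sum s p _ hlow
    rw [nsmul_eq_mul] at this
    linarith
  have hmpos : 0 < (N : ℝ)⁻¹ * s.card := by positivity
  have hpos : 0 < ∑ i ∈ s, p i := lt_of_lt_of_le (by positivity) hmass
  calc t * ∑ i ∈ s, p i
      ≤ (∑ i ∈ s, p i) * Real.logb 2 ((∑ i ∈ s, p i) / ((N : ℝ)⁻¹ * s.card)) := by
        rw [mul_comm]
        gcongr
        rw [Real.le_logb_iff_rpow_le one_lt_two (by positivity), le_div_iff₀ hmpos]
        exact hmass
    _ ≤ D := sum_mul_logb_le_divergence hσ b hp hD s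

lemma exists_relEntropy_le [CompleteSpace H] {ρ σ : QState H} {N : ℕ} (hN : 0 < N)
    (hdim : Module.finrank ℂ H = N) (hσ : σ.op = ((N : ℂ)⁻¹) • (1 : H →L[ℂ] H)) {D : ℝ}
    (hD : ρ.divergence σ = (D : EReal)) (hD0 : 0 ≤ D) :
    ∃ S : ℝ, ρ.relEntropy σ = (S : EReal) ∧ ∀ c L : ℝ, 0 < c → c ≤ L → Real.logb 2 N ≤ L →
      S ≤ c + D * Real.log (L / c) := by
  obtain ⟨b, p, hp0, hp1, hp⟩ := ρ.exists_eigenbasis hdim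
  refine ⟨_, relEntropy_eq_sum hN hσ b hp, fun c L hc hcL hL => ?_⟩
  refine sum_mul_le_of_tail_le hp0 hp1 hc hcL (fun i => ?_) fun t _ =>
    mul_sum_tail_le_divergence hN hσ b hp0 hp hD hD0 t
  have hple : p i ≤ 1 := hp1 ▸ Finset.single_le_sum (fun j _ => hp0 j) (Finset.mem_univ i)
  linarith [Real.logb_nonpos one_lt_two (hp0 i) hple]

end

end QState

theorem theorem5 {H : Type*} [NormedAddCommGroup H] [InnerProductSpace ℂ H] [CompleteSpace H]
    [FiniteDimensional ℂ H] (N : ℕ) (hN : 0 < N) (hdim : Module.finrank ℂ H = N)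
    {M : ℕ} (E : QEnsemble H M)
    (havg : E.average.op = ((N : ℂ)⁻¹) • (1 : H →L[ℂ] H)) :
    ∃ K : ℝ, E.divergenceInfo = (K : EReal) ∧
      E.holevoInfo ≤
        ((K * (2 * Real.log (Real.logb 2 (N : ℝ)) - Real.log K + 1) + 16 : ℝ) : EReal) := by
  choose D hD hD0 hDL using fun j =>
    QState.exists_divergence_eq_coe (ρ := E.state j) hN hdim havg
  choose S hS hSle using fun j => QState.exists_relEntropy_le hN hdim havg (hD j) (hD0 j)
  set K : ℝ := ∑ j, E.weight j * D j with hK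
  have hw := E.weight_nonneg
  have hK0 : 0 ≤ K := Finset.sum_nonneg fun j _ => mul_nonneg (hw j) (hD0 j)
  have hKL : K ≤ Real.logb 2 N := by
    calc K ≤ ∑ j, E.weight j * Real.logb 2 N :=
          Finset.sum_le_sum fun j _ => mul_le_mul_of_nonneg_left (hDL j) (hw j)
      _ = Real.logb 2 N := by rw [← Finset.sum_mul, E.weight_sum, one_mul]
  have hχ : ∀ c L : ℝ, 0 < c → c ≤ L → Real.logb 2 N ≤ L →
      ∑ j, E.weight j * S j ≤ c + K * Real.log (L / c) := fun c L hc hcL hL => by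
    calc ∑ j, E.weight j * S j ≤ ∑ j, E.weight j * (c + D j * Real.log (L / c)) :=
          Finset.sum_le_sum fun j _ => mul_le_mul_of_nonneg_left (hSle j c L hc hcL hL) (hw j)
      _ = c + K * Real.log (L / c) := by
          simp only [mul_add, Finset.sum_add_distrib, ← Finset.sum_mul, E.weight_sum, one_mul,
            ← mul_assoc, ← hK]
  refine ⟨K, ?_, ?_⟩
  · simp only [QEnsemble.divergenceInfo, hD, ← EReal.coe_mul, ← EReal.coe_sum, hK]
  · simp only [QEnsemble.holevoInfo, hS, ← EReal.coe_mul, ← EReal.coe_sum]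
    rw [EReal.coe_le_coe_iff]
    rcases hK0.eq_or_lt with h0 | hpos
    -- With `K = 0` the choice `c = K` is not allowed; `c = 1` gives `χ ≤ 1`. The maximum keeps `c ≤
    -- L` even when `log N = 0`.
    · have := hχ 1 (max (Real.logb 2 N) 1) one_pos (le_max_right _ _) (le_max_left _ _)
      rw [← h0] at this ⊢
      linarith
    -- The cutoff `c = K` minimises `c + K ln(L / c)`.
    · have h1 := hχ K _ hpos hKL le_rfl
      have hLpos : 0 < Real.logb 2 N := hpos.trans_le hKL
      have hN2 : (2 : ℝ) ≤ N := by
        have : N ≠ 1 := by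
          rintro rfl
          simp at hLpos
        exact_mod_cast (by omega : 2 ≤ N)
      have hL1 : 1 ≤ Real.logb 2 N := by
        rw [Real.le_logb_iff_rpow_le one_lt_two (by linarith), Real.rpow_one]
        exact hN2
      rw [Real.log_div hLpos.ne' hpos.ne'] at h1
      -- The claimed bound exceeds `h1` by `K ln log N + 16`, nonnegative since `log N ≥ 1`.
      nlinarith [mul_nonneg hK0 (Real.log_nonneg hL1)]
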